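/- All graphs are finite and simple. For a graph $G$ and an integer $k\ge 1$, a \emph{stable $k$-partition} of $G$ is a multiset $P=\{V_1,\dots,V_k\}$ of $k$ independent sets of $G$ (empty sets allowed) such that every vertex of $G$ lies in exactly one $V_i$; for $v\in V(G)$ write $P-v=\{V_1\setminus\{v\},\dots,V_k\setminus\{v\}\}$, again a multiset of $k$ sets. The \emph{Bell $k$-coloring graph} $\mathcal{B}_k(G)$ has the stable $k$-partitions of $G$ as vertices, and two distinct partitions $P,Q$ are adjacent if and only if $P-v=Q-v$ for some $v\in V(G)$. Let $\overline{G}$ denote the complement of $G$, and $C_n$ the cycle on $n\ge 3$ vertices. \textbf{Theorem.} Every tree and every cycle $C_n$ ($n\ge 3$) is isomorphic to $\mathcal{B}_k(G)$ for some graph $G$ and some $k\ge 1$. More specifically: \begin{enumerate} \item For every $k\ge 2$, $\mathcal{B}_{k+1}(\overline{C_{2k+1}})\cong C_{2k+1}$. \item For every $k\ge 2$, $\mathcal{B}_{k+1}(\overline{G_{2k}})\cong C_{2k+2}$, where the ear graph $G_{2k}$ has the $2k+1$ vertices $u,w,v_1,\dots,v_{2k-1}$ and the edges $v_iv_{i+1}$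 ($1\le i\le 2k-2$), $uv_1$, $wv_1$, $uv_{2k-1}$, $wv_{2k-1}$. \item For every tree $T$ of order $n\ge 1$, $\mathcal{B}_n(\overline{T_s})\cong T$, where $T_s$ is the tree obtained from $T$ by subdividing each edge once. \end{enumerate} -/

import Mathlib

universe u

namespace BellColoring

/-- A stable `k`-partition of `G`: a multiset of `k` independent sets such that every vertex lies
in exactly one member, counted with multiplicity. Empty (and repeated empty) members are allowed. -/
@[ext]
structure StablePartition {V : Type u} (G : SimpleGraph V) (k : ℕ) where
  /-- the unordered parts -/
  parts : Multiset (Set V)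
  card_parts : parts.card = k
  indep : ∀ s ∈ parts, G.IsIndepSet s
  partition : open Classical in ∀ x : V, parts.countP (fun s => x ∈ s) = 1

/-- `P - x`: delete the vertex `x` from its part, keeping all `k` parts (one may become empty). -/
def StablePartition.remove {V : Type u} {G : SimpleGraph V} {k : ℕ}
    (P : StablePartition G k) (x : V) : Multiset (Set V) :=
  P.parts.map (fun s => s \ {x})

/-- The Bell `k`-coloring graph of `G`: distinct stable `k`-partitions `P`, `Q` are adjacent when
`P - x = Q - x` for some vertex `x` of `G`. -/
def bellColoringGraph {V : Type u} (G : SimpleGraph V) (k : ℕ) :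
    SimpleGraph (StablePartition G k) where
  Adj P Q := P ≠ Q ∧ ∃ x : V, P.remove x = Q.remove x
  symm := ⟨fun _ _ h => ⟨h.1.symm, h.2.imp fun _ hx => hx.symm⟩⟩
  loopless := ⟨fun _ h => h.1 rfl⟩

/-- `H` is (isomorphic to) the Bell `k`-coloring graph of some finite graph, for some `k ≥ 1`. -/
def IsBellColoringGraph {V : Type u} (H : SimpleGraph V) : Prop :=
  ∃ (W : Type u) (_ : Finite W) (G : SimpleGraph W) (k : ℕ),
    1 ≤ k ∧ Nonempty (bellColoringGraph G k ≃g H)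

/-- The graph obtained from `G` by subdividing every edge once: the new vertices are the edges
of `G`, and each is joined to exactly its two ends. -/
def subdivision {V : Type u} (G : SimpleGraph V) : SimpleGraph (V ⊕ G.edgeSet) where
  Adj
    | .inl x, .inr e => x ∈ (e : Sym2 V)
    | .inr e, .inl x => x ∈ (e : Sym2 V)
    | _, _ => False
  symm := ⟨by rintro (x | e) (y | f) h <;> exact h⟩
  loopless := ⟨by rintro (x | e) h <;> exact h⟩

/-- The ear graph on `n + 1` vertices (used for even `n ≥ 4`): a path `v₁ ⋯ v_{n-1}`
together with two further vertices `u, w`, each joined to exactly `v₁` and `v_{n-1}`.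
Here `inl 0, inl 1` are `u, w`, and `inr i` is `v_{i+1}`. -/
def earGraph (n : ℕ) : SimpleGraph (Fin 2 ⊕ Fin (n - 1)) where
  Adj
    | .inl _, .inl _ => False
    | .inl _, .inr i => i.val = 0 ∨ i.val + 2 = n
    | .inr i, .inl _ => i.val = 0 ∨ i.val + 2 = n
    | .inr i, .inr j => i.val + 1 = j.val ∨ j.val + 1 = i.val
  symm := ⟨by
    rintro (a | i) (b | j) h
    · exact h
    · exact h
    · exact h
    · exact h.symm⟩
  loopless := ⟨by
    rintro (a | i) h
    · exact h
    · rcases h with h | h <;> omega⟩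

end BellColoring

/-!
The graphs whose complements appear here (odd cycles of length at least five, ear graphs and
subdivided trees) are triangle-free and have `2m + 1` vertices, and the number of parts is
`m + 1`. An independent set of `Hᶜ` is a clique of `H`, hence has at most two elements, and
counting forces every stable `(m + 1)`-partition to consist of `m` edges of `H` and a single
vertex: it is a near-perfect matching. Two of these agree off a vertex `v` exactly when one arises
from the other by a slide: the unmatched vertex `a` is matched to a neighbour `v`, whose former
partner becomes unmatched. So the Bell colouring graph is the graph of slides
(`nonempty_bellColoringGraph_compl_iso_slideGraph`), and it remains to follow the unmatched vertex.

* In `C_{2k+1}` a near-perfect matching is determined by its unmatched vertex, and a slide moves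
  that vertex by two steps. As two is invertible modulo `2k + 1`, this is a cycle.
* In the subdivision of a tree `T` the unmatched vertex is a vertex `r` of `T`, and every other
  vertex is matched to the edge towards its parent in `T` rooted at `r`. A slide moves `r` along an
  edge of `T`.
* Every near-perfect matching of the ear graph lies on exactly one of two Hamiltonian paths, which
  differ by exchanging their ends `u` and `w`. On each path the matching is determined by its
  unmatched vertex, at an even position, and slides walk through the `k + 1` such positions. At
  either end a further slide leads to the other path, and the two walks close up to `C_{2k+2}`.

The cycles `C₃` and `C₄` are Bell colouring graphs of an edge with one or two isolated vertices.

Passing between partitions and matchings uses that a stable partition is determined by the relation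
of lying in a common part (`multiset_ext_of_common_member`), so that stable `k`-partitions are
proper `k`-colourings up to their kernels (`nonempty_iso_of_kernels`).
-/

namespace BellColoring

/-! ### Stable partitions as kernels of colourings -/

section

variable {V : Type u}

open Classical in
theorem eq_of_mem_of_countP_le_one {m : Multiset (Set V)} {x : V}
    (h : m.countP (fun s => x ∈ s) ≤ 1) {s t : Set V} (hs : s ∈ m) (ht : t ∈ m)
    (hxs : x ∈ s) (hxt : x ∈ t) : s = t := by
  by_contra hne
  obtain ⟨m', rfl⟩ := Multiset.exists_cons_of_mem hs
  have ht' : t ∈ m' := (Multiset.mem_cons.1 ht).resolve_left (Ne.symm hne)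
  rw [Multiset.countP_cons_of_pos (p := fun s => x ∈ s) _ hxs] at h
  have : 0 < m'.countP (fun s => x ∈ s) := Multiset.countP_pos.2 ⟨t, ht', hxt⟩
  omega

open Classical in
theorem nodup_filter_nonempty {m : Multiset (Set V)}
    (h : ∀ x, m.countP (fun s => x ∈ s) ≤ 1) : (m.filter Set.Nonempty).Nodup := by
  rw [Multiset.nodup_iff_count_le_one]
  intro s
  by_cases hs : s.Nonempty
  · obtain ⟨x, hx⟩ := hs
    refine le_trans ?_ (h x)
    rw [Multiset.count, Multiset.countP_eq_card_filter, Multiset.countP_eq_card_filter]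
    refine Multiset.card_le_card ((Multiset.filter_le_filter _ (Multiset.filter_le _ _)).trans
      (Multiset.monotone_filter_right _ ?_))
    rintro t rfl
    exact hx
  · rw [Multiset.count_eq_zero_of_notMem]
    · omega
    · simp [hs]

open Classical in
/-- A family of disjoint sets, with repetitions of the empty set allowed, is determined by its
size and by the relation of lying in a common member. -/
theorem multiset_ext_of_common_member {m₁ m₂ : Multiset (Set V)} (hc : m₁.card = m₂.card)
    (h₁ : ∀ x, m₁.countP (fun s => x ∈ s) ≤ 1) (h₂ : ∀ x, m₂.countP (fun s => x ∈ s) ≤ 1)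
    (hrel : ∀ x y, (∃ s ∈ m₁, x ∈ s ∧ y ∈ s) ↔ ∃ s ∈ m₂, x ∈ s ∧ y ∈ s) : m₁ = m₂ := by
  have key : ∀ {m m' : Multiset (Set V)}, (∀ x, m.countP (fun s => x ∈ s) ≤ 1) →
      (∀ x, m'.countP (fun s => x ∈ s) ≤ 1) →
      (∀ x y, (∃ s ∈ m, x ∈ s ∧ y ∈ s) ↔ ∃ s ∈ m', x ∈ s ∧ y ∈ s) →
      ∀ s ∈ m, s.Nonempty → s ∈ m' := by
    intro m m' h h' hr s hs ⟨x, hx⟩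
    obtain ⟨t, ht, hxt, -⟩ := (hr x x).1 ⟨s, hs, hx, hx⟩
    have : s = t := by
      ext y
      constructor
      · intro hy
        obtain ⟨t', ht', hxt', hyt'⟩ := (hr x y).1 ⟨s, hs, hx, hy⟩
        rwa [eq_of_mem_of_countP_le_one (h' x) ht ht' hxt hxt']
      · intro hy
        obtain ⟨t', ht', hxt', hyt'⟩ := (hr x y).2 ⟨t, ht, hxt, hy⟩
        rwa [eq_of_mem_of_countP_le_one (h x) hs ht' hx hxt']
    exact this ▸ ht
  have hf : m₁.filter Set.Nonempty = m₂.filter Set.Nonempty := by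
    rw [(nodup_filter_nonempty h₁).ext (nodup_filter_nonempty h₂)]
    intro s
    simp only [Multiset.mem_filter]
    exact ⟨fun ⟨a, b⟩ => ⟨key h₁ h₂ hrel s a b, b⟩,
      fun ⟨a, b⟩ => ⟨key h₂ h₁ (fun x y => (hrel x y).symm) s a b, b⟩⟩
  have he : ∀ m : Multiset (Set V), m.filter (fun s => ¬ s.Nonempty) =
      Multiset.replicate (m.card - (m.filter Set.Nonempty).card) ∅ := by
    intro m
    rw [Multiset.eq_replicate]
    constructor
    · have := congrArg Multiset.card (Multiset.filter_add_not Set.Nonempty m)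
      rw [Multiset.card_add] at this
      omega
    · intro s hs
      exact Set.not_nonempty_iff_eq_empty.1 (Multiset.mem_filter.1 hs).2
  rw [← Multiset.filter_add_not Set.Nonempty m₁, ← Multiset.filter_add_not Set.Nonempty m₂,
    he m₁, he m₂, hf, hc]

variable {G : SimpleGraph V} {k : ℕ}

open Classical in
/-- The partition of the vertices into the `k` colour classes of a proper `k`-colouring. -/
def StablePartition.ofColoring (c : V → Fin k) (hc : ∀ x y, G.Adj x y → c x ≠ c y) :
    StablePartition G k where
  parts := (Finset.univ : Finset (Fin k)).val.map fun i => {x | c x = i}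
  card_parts := by simp
  indep := by
    intro s hs
    obtain ⟨i, -, rfl⟩ := Multiset.mem_map.1 hs
    intro x hx y hy _ hadj
    exact hc x y hadj (hx.trans (Eq.symm hy))
  partition := by
    intro x
    rw [Multiset.countP_map, ← Finset.filter_val]
    refine Finset.card_eq_one.2 ⟨c x, ?_⟩
    ext i
    simp [eq_comm]

theorem StablePartition.exists_eq_ofColoring (P : StablePartition G k) :
    ∃ (c : V → Fin k) (hc : ∀ x y, G.Adj x y → c x ≠ c y), P = .ofColoring c hc := by
  classical
  obtain ⟨l, hl⟩ := Quot.exists_rep P.parts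
  have hl' : P.parts = (l : Multiset (Set V)) := hl.symm
  have hk : l.length = k := by rw [← P.card_parts, hl', Multiset.coe_card]
  subst hk
  have hparts : P.parts = (Finset.univ : Finset (Fin l.length)).val.map l.get := by
    rw [Fin.univ_val_map, List.ofFn_get, hl']
  have huniq : ∀ x, ∃ i : Fin l.length, ∀ j, x ∈ l.get j ↔ i = j := by
    intro x
    have h := P.partition x
    rw [hparts, Multiset.countP_map, ← Finset.filter_val] at h
    obtain ⟨i, hi⟩ := Finset.card_eq_one.1 h
    refine ⟨i, fun j => ?_⟩
    have := Finset.ext_iff.1 hi j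
    simp only [Finset.mem_filter, Finset.mem_univ, true_and, Finset.mem_singleton] at this
    rw [this, eq_comm]
  choose c hc using huniq
  have hprop : ∀ x y, G.Adj x y → c x ≠ c y := by
    intro x y hadj heq
    have hmem : l.get (c x) ∈ P.parts := by
      rw [hl']
      exact Multiset.mem_coe.2 (List.get_mem l (c x))
    exact P.indep _ hmem ((hc x _).2 rfl) ((hc y _).2 heq.symm) hadj.ne hadj
  refine ⟨c, hprop, ?_⟩
  ext1
  rw [hparts]
  change _ = (Finset.univ : Finset (Fin l.length)).val.map fun i => {x | c x = i}
  congr 1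
  ext i x
  exact hc x i

theorem StablePartition.ofColoring_eq_iff {c d : V → Fin k}
    {hc : ∀ x y, G.Adj x y → c x ≠ c y} {hd : ∀ x y, G.Adj x y → d x ≠ d y} :
    (ofColoring c hc : StablePartition G k) = ofColoring d hd ↔
      ∀ x y, c x = c y ↔ d x = d y := by
  classical
  have hrel : ∀ (c : V → Fin k) (hc : ∀ x y, G.Adj x y → c x ≠ c y) (x y : V),
      (∃ s ∈ (ofColoring c hc).parts, x ∈ s ∧ y ∈ s) ↔ c x = c y := by
    intro c hc x y
    simp only [ofColoring, Multiset.mem_map]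
    constructor
    · rintro ⟨_, ⟨i, -, rfl⟩, hx, hy⟩
      exact hx.trans (Eq.symm hy)
    · intro h
      exact ⟨_, ⟨c x, Finset.mem_univ_val _, rfl⟩, rfl, h.symm⟩
  constructor
  · intro h x y
    rw [← hrel c hc, h, hrel]
  · intro h
    ext1
    refine multiset_ext_of_common_member ?_ ?_ ?_ ?_
    · rw [card_parts, card_parts]
    · intro x
      exact (ofColoring c hc).partition x |>.le
    · intro x
      exact (ofColoring d hd).partition x |>.le
    · intro x y
      rw [hrel, hrel, h]

theorem StablePartition.remove_ofColoring_eq_iff {c d : V → Fin k}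
    {hc : ∀ x y, G.Adj x y → c x ≠ c y} {hd : ∀ x y, G.Adj x y → d x ≠ d y} {v : V} :
    (ofColoring c hc : StablePartition G k).remove v = (ofColoring d hd).remove v ↔
      ∀ x y, x ≠ v → y ≠ v → (c x = c y ↔ d x = d y) := by
  classical
  have hrel : ∀ (c : V → Fin k) (hc : ∀ x y, G.Adj x y → c x ≠ c y) (x y : V),
      (∃ s ∈ (ofColoring c hc).remove v, x ∈ s ∧ y ∈ s) ↔ c x = c y ∧ x ≠ v ∧ y ≠ v := by
    intro c hc x y
    simp only [remove, ofColoring, Multiset.map_map, Multiset.mem_map]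
    constructor
    · rintro ⟨_, ⟨i, -, rfl⟩, hx, hy⟩
      exact ⟨hx.1.trans (Eq.symm hy.1), hx.2, hy.2⟩
    · rintro ⟨h, hx, hy⟩
      exact ⟨_, ⟨c x, Finset.mem_univ_val _, rfl⟩, ⟨rfl, hx⟩, ⟨h.symm, hy⟩⟩
  have hle : ∀ (P : StablePartition G k) (x : V),
      @Multiset.countP _ (fun s => x ∈ s) (fun _ => Classical.propDecidable _)
        (P.remove v) ≤ 1 := by
    intro P x
    rw [← P.partition x, remove]
    refine (Multiset.countP_map _ _ _).trans_le ?_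
    rw [Multiset.countP_eq_card_filter]
    refine Multiset.card_le_card ?_
    convert Multiset.monotone_filter_right P.parts (p := fun s => x ∈ s \ {v})
      (q := fun s => x ∈ s) fun s hs => hs.1
  constructor
  · intro h x y hx hy
    have h1 := hrel c hc x y
    rw [h, hrel] at h1
    tauto
  · intro h
    refine multiset_ext_of_common_member ?_ (hle _) (hle _) ?_
    · simp only [remove, Multiset.card_map, card_parts]
    · intro x y
      rw [hrel, hrel]
      have := h x y
      tauto

/-- A description of the Bell colouring graph by equivalence relations: a graph `H` is isomorphic
to it once the vertices of `H` parametrize, without repetition, the kernels `r w` of the proper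
`k`-colourings, and adjacency in `H` is agreement of the kernels away from one vertex. -/
theorem nonempty_iso_of_kernels {W : Type*} {H : SimpleGraph W} (r : W → V → V → Prop)
    (hr : ∀ w, ∃ c : V → Fin k, (∀ x y, G.Adj x y → c x ≠ c y) ∧ ∀ x y, r w x y ↔ c x = c y)
    (hsurj : ∀ c : V → Fin k, (∀ x y, G.Adj x y → c x ≠ c y) →
      ∃ w, ∀ x y, r w x y ↔ c x = c y)
    (hinj : ∀ w w', (∀ x y, r w x y ↔ r w' x y) → w = w')
    (hadj : ∀ w w', H.Adj w w' ↔
      w ≠ w' ∧ ∃ v, ∀ x y, x ≠ v → y ≠ v → (r w x y ↔ r w' x y)) :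
    Nonempty (bellColoringGraph G k ≃g H) := by
  choose c hc hrc using hr
  have hbij : Function.Bijective fun w => (StablePartition.ofColoring (c w) (hc w) :
      StablePartition G k) := by
    constructor
    · intro w w' h
      refine hinj _ _ fun x y => ?_
      rw [hrc, hrc]
      exact StablePartition.ofColoring_eq_iff.1 h x y
    · intro P
      obtain ⟨d, hd, rfl⟩ := P.exists_eq_ofColoring
      obtain ⟨w, hw⟩ := hsurj d hd
      refine ⟨w, StablePartition.ofColoring_eq_iff.2 fun x y => ?_⟩
      rw [← hw, hrc]
  refine ⟨RelIso.symm ⟨Equiv.ofBijective _ hbij, ?_⟩⟩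
  intro w w'
  rw [hadj]
  simp only [Equiv.ofBijective_apply, bellColoringGraph,
    StablePartition.remove_ofColoring_eq_iff, hrc]
  rw [hbij.injective.ne_iff]

end

/-! ### Near-perfect matchings and slides -/

section

variable {V : Type u}

/-- A near-perfect matching of `H`, encoded as the involution that exchanges the two ends of each
matching edge and fixes exactly one vertex, the one left unmatched. -/
def IsNearPerfectMatching (H : SimpleGraph V) (f : V → V) : Prop :=
  (∀ x, f (f x) = x) ∧ (∀ x, f x = x ∨ H.Adj x (f x)) ∧ ∃! x, f x = x

/-- The near-perfect matchings of `H`. -/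
abbrev NearPerfectMatching (H : SimpleGraph V) := {f : V → V // IsNearPerfectMatching H f}

/-- The graph of near-perfect matchings of `H`, two being adjacent when one arises from the other
by a slide: the unmatched vertex `a` is matched to `v`, and the former partner `b` of `v` becomes
unmatched. -/
def slideGraph (H : SimpleGraph V) : SimpleGraph (NearPerfectMatching H) where
  Adj f g := ∃ a b v, a ≠ b ∧ f.1 a = a ∧ f.1 v = b ∧ g.1 b = b ∧ g.1 v = a ∧
    ∀ x, x ≠ a → x ≠ b → x ≠ v → f.1 x = g.1 x
  symm := ⟨by
    rintro f g ⟨a, b, v, hab, hfa, hfv, hgb, hgv, h⟩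
    exact ⟨b, a, v, hab.symm, hgb, hgv, hfa, hfv, fun x hb ha hv => (h x ha hb hv).symm⟩⟩
  loopless := ⟨by
    rintro f ⟨a, b, v, hab, -, hfv, -, hgv, -⟩
    exact hab (hgv.symm.trans hfv)⟩

variable {H : SimpleGraph V}

/-- Two involutions, each with a unique fixed point, that induce the same pairs away from `v` are
equal if `v` is a fixed point. -/
theorem eq_of_agree_off_fixed {f g : V → V} (hf : ∀ x, f (f x) = x) (hg : ∀ x, g (g x) = x)
    (hfu : ∀ x y, f x = x → f y = y → x = y) {v : V} (hv : f v = v)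
    (h : ∀ x, x ≠ v → f x ≠ v → f x ≠ x → g x = f x) : f = g := by
  have h1 : ∀ x, x ≠ v → g x = f x := fun x hx =>
    h x hx (fun h' => hx (by rw [← hf x, h', hv])) (fun h' => hx (hfu x v h' hv))
  funext x
  by_cases hx : x = v
  · subst hx
    by_contra hne
    have h2 := h1 (g x) (fun h' => hne (by rw [hv, h']))
    rw [hg] at h2
    have h3 := congrArg f h2
    rw [hf, hv] at h3
    exact hne (hv.trans h3)
  · exact (h1 x hx).symm

/-- The vertex left unmatched by a near-perfect matching. -/
noncomputable def unmatched (f : NearPerfectMatching H) : V :=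
  f.2.2.2.choose

theorem apply_unmatched (f : NearPerfectMatching H) :
    f.1 (unmatched f) = unmatched f :=
  f.2.2.2.choose_spec.1

theorem eq_unmatched {f : NearPerfectMatching H} {x : V} (hx : f.1 x = x) :
    x = unmatched f :=
  f.2.2.2.choose_spec.2 x hx

theorem adj_of_apply_eq (f : NearPerfectMatching H) {x y : V} (h : f.1 x = y)
    (hne : x ≠ y) : H.Adj x y := by
  rcases f.2.2.1 x with h' | h'
  · exact absurd (h'.symm.trans h) hne
  · rwa [h] at h'

theorem slideGraph_adj_iff (f g : NearPerfectMatching H) :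
    (slideGraph H).Adj f g ↔ f ≠ g ∧ ∃ v, ∀ x y, x ≠ v → y ≠ v →
      ((x = y ∨ f.1 x = y) ↔ (x = y ∨ g.1 x = y)) := by
  rw [← Subtype.coe_ne_coe]
  obtain ⟨f, hf, -, hfu⟩ := f
  obtain ⟨g, hg, -, hgu⟩ := g
  simp only [slideGraph]
  constructor
  · rintro ⟨a, b, v, hab, hfa, hfv, hgb, hgv, h⟩
    refine ⟨fun h => by grind, v, fun x y hx hy => ?_⟩
    have := hf v
    have := hg v
    by_cases hxa : x = a
    · grind
    · by_cases hxb : x = b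
      · grind
      · rw [h x hxa hxb hx]
  · rintro ⟨hne, v, h⟩
    have hA : ∀ x, x ≠ v → f x ≠ v → f x ≠ x → g x = f x := fun x h1 h2 h3 =>
      ((h x (f x) h1 h2).1 (Or.inr rfl)).resolve_left h3.symm
    have hB : ∀ x, x ≠ v → g x ≠ v → g x ≠ x → f x = g x := fun x h1 h2 h3 =>
      ((h x (g x) h1 h2).2 (Or.inr rfl)).resolve_left h3.symm
    have hfv : f v ≠ v := fun h' =>
      hne (eq_of_agree_off_fixed hf hg (fun _ _ => hfu.unique) h' hA)
    have hgv : g v ≠ v := fun h' =>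
      hne (eq_of_agree_off_fixed hg hf (fun _ _ => hgu.unique) h' hB).symm
    have hinjf : ∀ x, f x = v → x = f v := fun x hx => by rw [← hx, hf]
    have hinjg : ∀ x, g x = v → x = g v := fun x hx => by rw [← hx, hg]
    have hoff : ∀ x, x ≠ v → x ≠ f v → x ≠ g v → f x = g x := by
      intro x h1 h2 h3
      by_cases h4 : f x = x
      · by_cases h5 : g x = x
        · rw [h4, h5]
        · exact hB x h1 (fun h' => h3 (hinjg x h')) h5
      · exact (hA x h1 (fun h' => h2 (hinjf x h')) h4).symm
    have hfg : g v ≠ f v := by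
      intro h'
      apply hne
      funext x
      by_cases h1 : x = v
      · rw [h1, h']
      · by_cases h2 : x = f v
        · rw [h2, hf, ← h', hg]
        · exact hoff x h1 h2 (h' ▸ h2)
    refine ⟨g v, f v, v, hfg, ?_, rfl, ?_, rfl, fun x h1 h2 h3 => hoff x h3 h2 h1⟩
    · by_contra h'
      have := hA (g v) hgv (fun h2 => hfg (hinjf _ h2)) h'
      rw [hg] at this
      exact hfg (hinjf _ this.symm)
    · by_contra h'
      have := hB (f v) hfv (fun h2 => hfg (hinjg _ h2).symm) h'
      rw [hf] at this
      exact hfg (hinjg _ this.symm).symm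

/-- The classes of a near-perfect matching on `2m + 1` vertices are the fibres of a map to
`m + 1` colours. -/
theorem IsNearPerfectMatching.exists_coloring [Finite V] {m : ℕ} (hV : Nat.card V = 2 * m + 1)
    {f : V → V} (hf : IsNearPerfectMatching H f) :
    ∃ c : V → Fin (m + 1), ∀ x y, (x = y ∨ f x = y) ↔ c x = c y := by
  classical
  have := Fintype.ofFinite V
  obtain ⟨hff, -, a, ha, hau⟩ := hf
  let S : Setoid V := ⟨fun x y => x = y ∨ f x = y,
    ⟨fun _ => Or.inl rfl, by rintro x y (rfl | rfl) <;> simp [hff],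
      by rintro x y z (rfl | rfl) (rfl | rfl) <;> simp [hff]⟩⟩
  have hrel : ∀ x y, (Quotient.mk S x = Quotient.mk S y) ↔ (x = y ∨ f x = y) :=
    fun x y => Quotient.eq
  -- `R` picks one vertex from each class; `R` and `f '' R` share only the fixed vertex.
  let R : Finset V := Finset.univ.image (Quotient.out : Quotient S → V)
  have hR : R.card = Fintype.card (Quotient S) := by
    rw [Finset.card_image_of_injective _ Quotient.out_injective, Finset.card_univ]
  have hR' : (R.image f).card = R.card :=
    Finset.card_image_of_injective _ (Function.LeftInverse.injective hff)
  have hmemR : ∀ x ∈ R, ∀ y ∈ R, f x = y → x = y := by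
    intro x hx y hy hxy
    obtain ⟨p, -, rfl⟩ := Finset.mem_image.1 hx
    obtain ⟨q, -, rfl⟩ := Finset.mem_image.1 hy
    have := (hrel _ _).2 (Or.inr hxy)
    rw [Quotient.out_eq, Quotient.out_eq] at this
    rw [this]
  have hinter : (R ∩ R.image f).card ≤ 1 := by
    rw [← Finset.card_singleton a]
    refine Finset.card_le_card fun y hy => ?_
    obtain ⟨hy1, hy2⟩ := Finset.mem_inter.1 hy
    obtain ⟨x, hx, rfl⟩ := Finset.mem_image.1 hy2
    have h1 := hmemR x hx _ hy1 rfl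
    exact Finset.mem_singleton.2 (hau _ (by simp only [← h1]))
  have hle : Fintype.card (Quotient S) ≤ Fintype.card (Fin (m + 1)) := by
    have h1 := Finset.card_union_add_card_inter R (R.image f)
    have h2 := Finset.card_le_univ (R ∪ R.image f)
    rw [← Nat.card_eq_fintype_card, hV] at h2
    rw [Fintype.card_fin]
    omega
  obtain ⟨e⟩ := Function.Embedding.nonempty_of_card_le hle
  exact ⟨fun x => e (Quotient.mk S x), fun x y => by rw [e.injective.eq_iff, hrel]⟩

/-- In a triangle-free graph `H` on `2m + 1` vertices, `m + 1` cliques that cover the vertices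
are `m` edges and one vertex. -/
theorem exists_nearPerfectMatching_of_coloring [Finite V] {m : ℕ} (hV : Nat.card V = 2 * m + 1)
    (htri : ∀ x y z, H.Adj x y → H.Adj y z → ¬ H.Adj x z)
    (c : V → Fin (m + 1)) (hc : ∀ x y, Hᶜ.Adj x y → c x ≠ c y) :
    ∃ f, IsNearPerfectMatching H f ∧ ∀ x y, (x = y ∨ f x = y) ↔ c x = c y := by
  classical
  have := Fintype.ofFinite V
  have hadj : ∀ x y, x ≠ y → c x = c y → H.Adj x y := by
    intro x y hne h
    by_contra h'
    exact hc x y ((SimpleGraph.compl_adj _ _ _).2 ⟨hne, h'⟩) h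
  have hex : ∀ x, ∃ y, ∀ z, (x = z ∨ y = z) ↔ c x = c z := by
    intro x
    by_cases hx : ∃ y, x ≠ y ∧ c x = c y
    · obtain ⟨y, hne, hy⟩ := hx
      refine ⟨y, fun z => ⟨?_, fun hz => ?_⟩⟩
      · rintro (rfl | rfl)
        · rfl
        · exact hy
      · by_contra! h'
        exact htri x y z (hadj _ _ hne hy) (hadj _ _ h'.2 (hy.symm.trans hz)) (hadj _ _ h'.1 hz)
    · push Not at hx
      refine ⟨x, fun z => ⟨?_, fun hz => ?_⟩⟩
      · rintro (rfl | rfl) <;> rfl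
      · by_contra! h'
        exact hx z h'.1 hz
  choose f hf using hex
  have hcf : ∀ x, c x = c (f x) := fun x => (hf x _).1 (Or.inr rfl)
  -- The deficits `2 - |fibre|` of the `m + 1` colours add up to one.
  let F : Fin (m + 1) → Finset V := fun i => Finset.univ.filter fun x => c x = i
  have hF2 : ∀ i, (F i).card ≤ 2 := by
    intro i
    rcases (F i).eq_empty_or_nonempty with h | ⟨x, hx⟩
    · rw [h]
      exact Nat.zero_le _
    · refine (Finset.card_le_card (t := {x, f x}) fun z hz => ?_).trans Finset.card_le_two
      have h1 : c x = i := (Finset.mem_filter.1 hx).2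
      have h2 : c z = i := (Finset.mem_filter.1 hz).2
      have := (hf x z).2 (h1.trans h2.symm)
      simp only [Finset.mem_insert, Finset.mem_singleton]
      grind
  have hsum : ∑ i, (2 - (F i).card) = 1 := by
    have h1 : ∑ i, (F i).card = 2 * m + 1 := by
      rw [← hV, Nat.card_eq_fintype_card, ← Finset.card_univ]
      exact (Finset.card_eq_sum_card_fiberwise fun x _ => Finset.mem_univ (c x)).symm
    have h2 : ∑ i, (2 - (F i).card) + ∑ i, (F i).card = 2 * (m + 1) := by
      rw [← Finset.sum_add_distrib, Finset.sum_congr rfl fun i _ => Nat.sub_add_cancel (hF2 i)]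
      simp [mul_comm]
    omega
  have hfix : ∀ x, f x = x → (F (c x)).card = 1 := by
    intro x hx
    refine Finset.card_eq_one.2 ⟨x, Finset.ext fun z => ?_⟩
    have := hf x z
    simp only [F, Finset.mem_filter, Finset.mem_univ, true_and, Finset.mem_singleton]
    grind
  refine ⟨f, ⟨fun x => ?_, fun x => ?_, ?_⟩, hf⟩
  · have h1 := (hf (f x) x).2 (hcf x).symm
    have h2 := (hf (f x) (f (f x))).1 (Or.inr rfl)
    grind
  · by_cases h : f x = x
    · exact Or.inl h
    · exact Or.inr (hadj _ _ (Ne.symm h) (hcf x))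
  · have hi : ∃ i, 2 - (F i).card ≠ 0 := by
      by_contra! h
      rw [Finset.sum_eq_zero fun i _ => h i] at hsum
      omega
    obtain ⟨i, hi⟩ := hi
    have hi1 : 2 - (F i).card ≤ 1 := by
      rw [← hsum]
      exact Finset.single_le_sum (f := fun i => 2 - (F i).card) (fun _ _ => Nat.zero_le _)
        (Finset.mem_univ i)
    obtain ⟨x, hx⟩ := Finset.card_eq_one.1 (show (F i).card = 1 by omega)
    have hmem : ∀ z, z ∈ F i ↔ z = x := fun z => by rw [hx, Finset.mem_singleton]
    simp only [F, Finset.mem_filter, Finset.mem_univ, true_and] at hmem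
    have hxi := (hmem x).2 rfl
    refine ⟨x, (hmem _).1 ((hcf x).symm.trans hxi), fun y hy => ?_⟩
    by_contra hne
    have hcne : c y ≠ c x := fun h => hne ((hmem y).1 (h.trans hxi))
    have h3 : ∑ i ∈ {c y, c x}, (2 - (F i).card) ≤ 1 := by
      exact (Finset.sum_le_sum_of_subset (Finset.subset_univ _)).trans hsum.le
    rw [Finset.sum_pair hcne, hfix y hy, hxi, show (F i).card = 1 by omega] at h3
    omega

/-- For triangle-free `H` on `2m + 1` vertices, the stable `(m + 1)`-partitions of the complement
are the near-perfect matchings of `H`, and their adjacency is sliding. -/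
theorem nonempty_bellColoringGraph_compl_iso_slideGraph [Finite V] {m : ℕ}
    (hV : Nat.card V = 2 * m + 1) (htri : ∀ x y z, H.Adj x y → H.Adj y z → ¬ H.Adj x z) :
    Nonempty (bellColoringGraph Hᶜ (m + 1) ≃g slideGraph H) := by
  refine nonempty_iso_of_kernels (fun f x y => x = y ∨ f.1 x = y) ?_ ?_ ?_ slideGraph_adj_iff
  · rintro ⟨f, hf⟩
    obtain ⟨c, hc⟩ := hf.exists_coloring hV
    refine ⟨c, fun x y hadj h => ?_, hc⟩
    rw [SimpleGraph.compl_adj] at hadj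
    have h1 := hf.2.1 x
    have h2 := (hc x y).2 h
    grind
  · intro c hc
    obtain ⟨f, hf, h⟩ := exists_nearPerfectMatching_of_coloring hV htri c hc
    exact ⟨⟨f, hf⟩, h⟩
  · rintro ⟨f, hf⟩ ⟨g, hg⟩ h
    refine Subtype.ext (funext fun x => ?_)
    have h1 := h x (f x)
    have h2 := h x (g x)
    dsimp only at h1 h2 ⊢
    grind

/-- Every edge `av` at the unmatched vertex `a` allows a slide. -/
theorem exists_slide (f : NearPerfectMatching H) {a v : V} (ha : f.1 a = a)
    (hav : H.Adj a v) : ∃ g, (slideGraph H).Adj f g ∧ g.1 (f.1 v) = f.1 v ∧ g.1 a = v ∧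
      ∀ x, x ≠ a → x ≠ v → x ≠ f.1 v → g.1 x = f.1 x := by
  classical
  obtain ⟨f, hff, hfH, hfu⟩ := f
  dsimp only at ha ⊢
  have hfu' : ∀ x y, f x = x → f y = y → x = y := fun _ _ => hfu.unique
  have hne : a ≠ v := hav.ne
  have hfv : f v ≠ v := fun h => hne (hfu' _ _ ha h)
  have hfva : f v ≠ a := fun h => hne (by rw [← ha, ← h, hff])
  let g : V → V := fun x => if x = a then v else if x = v then a else if x = f v then x else f x
  have hg : ∀ x, g x = if x = a then v else if x = v then a else if x = f v then x else f x :=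
    fun _ => rfl
  have hgN : IsNearPerfectMatching H g := by
    refine ⟨fun x => ?_, fun x => ?_, f v, ?_, fun x hx => ?_⟩
    · have := hff x
      have := hff v
      grind
    · have := hfH x
      have := hav.symm
      grind
    · grind
    · dsimp only at hx
      have := hfu' x a
      grind
  refine ⟨⟨g, hgN⟩, ⟨a, f v, v, hfva.symm, ha, rfl, ?_, ?_, fun x h1 h2 h3 => ?_⟩, ?_, ?_,
    fun x h1 h2 h3 => ?_⟩ <;> dsimp only <;> grind

/-- Two involutions agree when, with respect to a rank function, they agree at every vertex that
neither of them sends to a vertex of smaller rank. -/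
theorem eq_of_rank {f g : V → V} (hf : ∀ x, f (f x) = x) (hg : ∀ x, g (g x) = x) (ρ : V → ℕ)
    (h : ∀ x, ρ (f x) < ρ x ∨ ρ (g x) < ρ x ∨ f x = g x) : f = g := by
  funext x
  induction hn : ρ x using Nat.strong_induction_on generalizing x with
  | _ n ih =>
    subst hn
    rcases h x with h | h | h
    · have := ih _ h (f x) rfl
      have h1 := congrArg g this
      rw [hf, hg] at h1
      exact h1.symm
    · have := ih _ h (g x) rfl
      have h1 := congrArg f this
      rw [hf, hg] at h1
      exact h1.symm
    · exact h

/-- In a properly two-coloured graph, the unmatched vertex of a near-perfect matching does not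
have the minority colour. -/
theorem card_le_of_fixed [Finite V] {f : V → V} (hf : IsNearPerfectMatching H f) (p : V → Prop)
    (hp : ∀ x y, H.Adj x y → (p x ↔ ¬ p y)) {a : V} (ha : f a = a) (hpa : ¬ p a) :
    Nat.card {x // p x} ≤ Nat.card {x // ¬ p x} := by
  refine Nat.card_le_card_of_injective (fun x => ⟨f x.1, ?_⟩) ?_
  · rcases hf.2.1 x.1 with h | h
    · exact absurd x.2 (hf.2.2.unique h ha ▸ hpa)
    · exact (hp _ _ h).1 x.2
  · intro x y h
    exact Subtype.ext ((Function.LeftInverse.injective hf.1) (Subtype.mk.inj h))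

/-- A path through all `2m + 1` vertices carries a near-perfect matching. -/
theorem exists_nearPerfectMatching_of_path {m : ℕ} (e : V ≃ Fin (2 * m + 1))
    (he : ∀ x y, (e x).val + 1 = (e y).val → H.Adj x y) : ∃ f, IsNearPerfectMatching H f := by
  let σ : ℕ → ℕ := fun i => if i = 0 then 0 else if i % 2 = 1 then i + 1 else i - 1
  have hσ : ∀ i, σ i = if i = 0 then 0 else if i % 2 = 1 then i + 1 else i - 1 := fun _ => rfl
  have hlt : ∀ i : Fin (2 * m + 1), σ i < 2 * m + 1 := by
    intro i
    have := i.2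
    rw [hσ]
    split_ifs <;> omega
  let f : V → V := fun x => e.symm ⟨σ (e x), hlt _⟩
  have hf : ∀ x, (e (f x)).val = σ (e x) := fun x => by simp [f]
  refine ⟨f, fun x => ?_, fun x => ?_, e.symm 0, ?_, fun x hx => ?_⟩
  · apply e.injective
    apply Fin.ext
    rw [hf, hf]
    simp only [hσ]
    grind
  · by_cases h0 : (e x).val = 0
    · left
      apply e.injective
      apply Fin.ext
      rw [hf, hσ, if_pos h0, h0]
    · right
      by_cases h1 : (e x).val % 2 = 1
      · apply he
        rw [hf, hσ, if_neg h0, if_pos h1]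
      · apply SimpleGraph.Adj.symm
        apply he
        rw [hf, hσ, if_neg h0, if_neg h1]
        omega
  · apply e.injective
    apply Fin.ext
    rw [hf, hσ]
    simp
  · have := hf x
    rw [hx, hσ] at this
    apply e.injective
    apply Fin.ext
    rw [Equiv.apply_symm_apply]
    change (e x).val = 0
    grind

end

/-! ### Recognizing cycles -/

section

/-- Labels in `ℤ/n` show a graph to be a cycle if they are distinct, differ by one across each
edge, and every vertex has a neighbour with the next label. -/
theorem nonempty_iso_cycleGraph {W : Type*} {G : SimpleGraph W} {n : ℕ} [Nonempty W]
    (L : W → Fin (n + 2)) (hinj : Function.Injective L)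
    (hadj : ∀ x y, G.Adj x y → L y = L x + 1 ∨ L x = L y + 1)
    (hsucc : ∀ x, ∃ y, G.Adj x y ∧ L y = L x + 1) :
    Nonempty (G ≃g SimpleGraph.cycleGraph (n + 2)) := by
  have hsurj : Function.Surjective L := by
    obtain ⟨x₀⟩ := ‹Nonempty W›
    have h : ∀ j : Fin (n + 2), ∃ x, L x = L x₀ + j := by
      intro j
      induction j using Fin.induction with
      | zero => exact ⟨x₀, by simp⟩
      | succ j ih =>
        obtain ⟨x, hx⟩ := ih
        obtain ⟨y, -, hy⟩ := hsucc x
        exact ⟨y, by rw [hy, hx, add_assoc, Fin.coeSucc_eq_succ]⟩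
    intro i
    obtain ⟨x, hx⟩ := h (i - L x₀)
    exact ⟨x, by rw [hx, add_sub_cancel]⟩
  have hbij : Function.Bijective L := ⟨hinj, hsurj⟩
  refine ⟨⟨Equiv.ofBijective L hbij, ?_⟩⟩
  intro x y
  rw [SimpleGraph.cycleGraph_adj, Equiv.ofBijective_apply, Equiv.ofBijective_apply]
  constructor
  · rintro (h | h)
    · obtain ⟨z, hz, hLz⟩ := hsucc y
      have : z = x := hinj (by rw [hLz, ← h, add_sub_cancel])
      exact this ▸ hz.symm
    · obtain ⟨z, hz, hLz⟩ := hsucc x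
      have : z = y := hinj (by rw [hLz, ← h, add_sub_cancel])
      exact this ▸ hz
  · intro h
    rcases hadj x y h with h | h
    · exact Or.inr (by rw [h, add_sub_cancel_left])
    · exact Or.inl (by rw [h, add_sub_cancel_left])

end

/-! ### Odd cycles -/

section

open Fin.CommRing in
/-- A slide in `C_{2k+1}` moves the unmatched vertex by two steps, so labelling a near-perfect
matching by half its unmatched vertex, in `ℤ/(2k+1)`, exhibits the cycle. -/
theorem nonempty_slideGraph_oddCycle_iso {n k : ℕ} (hn : n + 2 = 2 * k + 1) :
    Nonempty (slideGraph (SimpleGraph.cycleGraph (n + 2)) ≃g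
      SimpleGraph.cycleGraph (n + 2)) := by
  have hadj : ∀ x y : Fin (n + 2), (SimpleGraph.cycleGraph (n + 2)).Adj x y →
      y = x + 1 ∨ y = x - 1 := by
    intro x y h
    rw [SimpleGraph.cycleGraph_adj] at h
    rcases h with h | h
    · right
      rw [← h]
      ring
    · left
      rw [← h]
      ring
  have hadj' : ∀ x : Fin (n + 2), (SimpleGraph.cycleGraph (n + 2)).Adj x (x + 1) := by
    intro x
    rw [SimpleGraph.cycleGraph_adj]
    right
    ring
  -- `c` is the inverse of two
  obtain ⟨c, hc⟩ : ∃ c : Fin (n + 2), c + c = 1 := by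
    refine ⟨((k + 1 : ℕ) : Fin (n + 2)), ?_⟩
    have h : ((2 * k + 1 : ℕ) : Fin (n + 2)) = 0 := by
      rw [← hn]
      exact Fin.natCast_self _
    push_cast at h ⊢
    linear_combination h
  have hdec : ∀ a x : Fin (n + 2), x ≠ a → (x - 1 - a).val < (x - a).val := by
    intro a x hx
    have h1 : x - 1 - a = (x - a) - 1 := by ring
    have h2 : x - a ≠ 0 := sub_ne_zero.2 hx
    rw [h1, Fin.val_sub_one_of_ne_zero h2]
    have := Fin.val_ne_zero_iff.2 h2
    omega
  have : Nonempty (NearPerfectMatching (SimpleGraph.cycleGraph (n + 2))) := by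
    obtain ⟨f, hf⟩ := exists_nearPerfectMatching_of_path (H := SimpleGraph.cycleGraph (n + 2))
      (finCongr hn) (fun x y h => by
        have hy : y = x + 1 := by
          apply Fin.ext
          have := y.2
          change x.val + 1 = y.val at h
          rw [Fin.val_add_one_of_lt' (by omega), h]
        exact hy ▸ hadj' x)
    exact ⟨⟨f, hf⟩⟩
  refine nonempty_iso_cycleGraph (fun f => unmatched f * c) ?_ ?_ ?_
  · intro f g h
    have hfg : unmatched f = unmatched g := by
      dsimp only at h
      linear_combination 2 * h + (unmatched g - unmatched f) * hc
    refine Subtype.ext (eq_of_rank f.2.1 g.2.1 (fun x => (x - unmatched f).val) fun x => ?_)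
    by_cases hx : x = unmatched f
    · subst hx
      right; right
      rw [apply_unmatched, hfg, apply_unmatched]
    · rcases f.2.2.1 x with h1 | h1
      · exact absurd (eq_unmatched h1) hx
      rcases g.2.2.1 x with h2 | h2
      · exact absurd ((eq_unmatched h2).trans hfg.symm) hx
      rcases hadj _ _ h1 with h1 | h1
      · rcases hadj _ _ h2 with h2 | h2
        · right; right
          rw [h1, h2]
        · right; left
          rw [h2]
          exact hdec _ _ hx
      · left
        rw [h1]
        exact hdec _ _ hx
  · rintro f g ⟨a, b, v, hab, hfa, hfv, hgb, hgv, -⟩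
    rw [← eq_unmatched hfa, ← eq_unmatched hgb]
    have h1 : v ≠ b := by
      rintro rfl
      exact hab (f.2.2.2.unique hfa hfv)
    have h2 : v ≠ a := by
      rintro rfl
      exact hab (g.2.2.2.unique hgv hgb)
    rcases hadj _ _ (adj_of_apply_eq f hfv h1) with h3 | h3 <;>
      rcases hadj _ _ (adj_of_apply_eq g hgv h2) with h4 | h4
    · exact absurd (h4.trans h3.symm) hab
    · left
      linear_combination c * h3 - c * h4 + hc
    · right
      linear_combination c * h4 - c * h3 + hc
    · exact absurd (h4.trans h3.symm) hab
  · intro f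
    obtain ⟨g, hg, hg1, -, -⟩ := exists_slide f (apply_unmatched f) (hadj' (unmatched f))
    refine ⟨g, hg, ?_⟩
    rw [← eq_unmatched hg1]
    have h1 : unmatched f ≠ unmatched f + 1 := (hadj' _).ne
    rcases f.2.2.1 (unmatched f + 1) with h2 | h2
    · exact absurd (eq_unmatched h2).symm h1
    · rcases hadj _ _ h2 with h3 | h3
      · linear_combination c * h3 + hc
      · exfalso
        rw [add_sub_cancel_right] at h3
        have := f.2.1 (unmatched f + 1)
        rw [h3, apply_unmatched] at this
        exact h1 this

open Fin.CommRing in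
theorem nonempty_bellColoringGraph_oddCycle_iso {k : ℕ} (hk : 2 ≤ k) :
    Nonempty (bellColoringGraph (SimpleGraph.cycleGraph (2 * k + 1))ᶜ (k + 1) ≃g
      SimpleGraph.cycleGraph (2 * k + 1)) := by
  obtain ⟨j, rfl⟩ : ∃ j, k = j + 2 := ⟨k - 2, by omega⟩
  change Nonempty (bellColoringGraph (SimpleGraph.cycleGraph (2 * j + 3 + 2))ᶜ (j + 2 + 1) ≃g
    SimpleGraph.cycleGraph (2 * j + 3 + 2))
  have h3 : (1 + 1 + 1 : Fin (2 * j + 3 + 2)) ≠ 0 := by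
    intro h
    have := congrArg Fin.val h
    simp [Fin.val_add] at this
    rw [Nat.mod_eq_of_lt (by omega)] at this
    omega
  have h1 : (1 : Fin (2 * j + 3 + 2)) ≠ 0 := one_ne_zero
  obtain ⟨e⟩ := nonempty_bellColoringGraph_compl_iso_slideGraph (m := j + 2)
    (H := SimpleGraph.cycleGraph (2 * j + 3 + 2)) (by simp; ring) (by
      intro x y z
      simp only [SimpleGraph.cycleGraph_adj]
      rintro (h | h) (h' | h') (h'' | h'')
      · exact h1 (by linear_combination h'' - h - h')
      · exact h3 (by linear_combination - h - h' - h'')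
      · exact h1 (by linear_combination h - h' - h'')
      · exact h1 (by linear_combination h' - h - h'')
      · exact h1 (by linear_combination h' - h - h'')
      · exact h1 (by linear_combination h - h' - h'')
      · exact h3 (by linear_combination - h - h' - h'')
      · exact h1 (by linear_combination h'' - h - h'))
  obtain ⟨e'⟩ := nonempty_slideGraph_oddCycle_iso (n := 2 * j + 3) (k := j + 2) (by ring)
  exact ⟨e.trans e'⟩

end

/-! ### The cycles on three and four vertices -/

section

/-- The complement of the path on three vertices, with three colours: each of its three stable
partitions is determined by the part of the isolated vertex `2`. -/
theorem isBellColoringGraph_cycleGraph_three :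
    IsBellColoringGraph (SimpleGraph.cycleGraph 3) := by
  let r : Fin 3 → Fin 3 → Fin 3 := ![![0, 1, 2], ![0, 1, 0], ![0, 1, 1]]
  refine ⟨Fin 3, inferInstance, SimpleGraph.fromRel fun x y => x = 0 ∧ y = 1, 3, by omega,
    nonempty_iso_of_kernels (fun w x y => r w x = r w y) (fun w => ⟨r w, ?_, fun _ _ => Iff.rfl⟩)
    ?_ ?_ ?_⟩
  · simp only [SimpleGraph.fromRel_adj]
    revert w
    decide
  · simp only [SimpleGraph.fromRel_adj]
    decide
  · decide
  · simp only [SimpleGraph.cycleGraph_adj]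
    decide

/-- With two colours, the ends of the only edge are separated, and each of the isolated vertices
`2` and `3` chooses its part freely. -/
theorem isBellColoringGraph_cycleGraph_four :
    IsBellColoringGraph (SimpleGraph.cycleGraph 4) := by
  let r : Fin 4 → Fin 4 → Fin 2 := ![![0, 1, 0, 0], ![0, 1, 0, 1], ![0, 1, 1, 1], ![0, 1, 1, 0]]
  refine ⟨Fin 4, inferInstance, SimpleGraph.fromRel fun x y => x = 0 ∧ y = 1, 2, by omega,
    nonempty_iso_of_kernels (fun w x y => r w x = r w y) (fun w => ⟨r w, ?_, fun _ _ => Iff.rfl⟩)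
    ?_ ?_ ?_⟩
  · simp only [SimpleGraph.fromRel_adj]
    revert w
    decide
  · simp only [SimpleGraph.fromRel_adj]
    decide
  · decide
  · simp only [SimpleGraph.cycleGraph_adj]
    decide

end

/-! ### Subdivided trees -/

section

variable {V : Type u} {T : SimpleGraph V}

theorem subdivision_triangleFree (x y z : V ⊕ T.edgeSet) (h₁ : (subdivision T).Adj x y)
    (h₂ : (subdivision T).Adj y z) : ¬ (subdivision T).Adj x z := by
  rcases x with x | x <;> rcases y with y | y <;> rcases z with z | z <;>
    simp_all [subdivision]

/-- In a rooted tree, sending each vertex other than the root to the edge towards its parent is a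
bijection onto the edges. -/
theorem exists_parentEdge [Finite V] (hT : T.IsTree) (r : V) :
    ∃ p : {x // x ≠ r} ≃ T.edgeSet, ∀ x : {x // x ≠ r}, ∃ y,
      ((p x : T.edgeSet) : Sym2 V) = s(x.1, y) ∧ T.dist r y < T.dist r x := by
  obtain ⟨hconn, hcard⟩ := SimpleGraph.isTree_iff_connected_and_card.1 hT
  have hpar : ∀ x : {x // x ≠ r}, ∃ y, T.Adj x.1 y ∧ T.dist r y < T.dist r x := by
    rintro ⟨x, hx⟩
    obtain ⟨w, hw⟩ := hconn.exists_walk_length_eq_dist x r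
    cases w with
    | nil => exact absurd rfl hx
    | @cons _ y _ h w =>
      refine ⟨y, h, ?_⟩
      rw [SimpleGraph.dist_comm (v := y), SimpleGraph.dist_comm (v := x), ← hw,
        SimpleGraph.Walk.length_cons]
      exact Nat.lt_succ_of_le (SimpleGraph.dist_le w)
  choose q hq hqd using hpar
  let p : {x // x ≠ r} → T.edgeSet := fun x => ⟨s(x.1, q x), hq x⟩
  have hinj : Function.Injective p := by
    intro x y h
    have h1 : s(x.1, q x) = s(y.1, q y) := congrArg Subtype.val h
    rcases Sym2.eq_iff.1 h1 with h2 | h2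
    · exact Subtype.ext h2.1
    · have h3 := hqd x
      have h4 := hqd y
      rw [h2.2] at h3
      rw [← h2.1] at h4
      omega
  have hc : Nat.card {x // x ≠ r} = Nat.card T.edgeSet := by
    classical
    have := Fintype.ofFinite V
    have h1 := Fintype.card_subtype_compl (fun x : V => x = r)
    rw [Fintype.card_subtype_eq] at h1
    have h2 : Nat.card {x // x ≠ r} = Fintype.card V - 1 := by
      rw [Nat.card_eq_fintype_card]
      exact h1
    rw [h2, ← Nat.card_eq_fintype_card]
    omega
  refine ⟨Equiv.ofBijective p ((Nat.bijective_iff_injective_and_card p).2 ⟨hinj, hc⟩),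
    fun x => ⟨q x, rfl, hqd x⟩⟩

/-- For each vertex `r` of a tree, its subdivision has exactly one near-perfect matching that
misses `r`: the one that matches each other vertex to the edge towards its parent. -/
theorem existsUnique_nearPerfectMatching_subdivision [Finite V] (hT : T.IsTree) (r : V) :
    ∃! f : V ⊕ T.edgeSet → V ⊕ T.edgeSet,
      IsNearPerfectMatching (subdivision T) f ∧ f (.inl r) = .inl r := by
  classical
  obtain ⟨p, hp⟩ := exists_parentEdge hT r
  let f : V ⊕ T.edgeSet → V ⊕ T.edgeSet := Sum.elim
    (fun x => if h : x = r then .inl r else .inr (p ⟨x, h⟩)) fun e => .inl (p.symm e).1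
  have hfr : f (.inl r) = .inl r := by simp [f]
  have hfx : ∀ x (h : x ≠ r), f (.inl x) = .inr (p ⟨x, h⟩) := fun x h => by simp [f, h]
  have hfe : ∀ e, f (.inr e) = .inl (p.symm e).1 := fun _ => rfl
  have hmem : ∀ x, x.1 ∈ (p x : Sym2 V) := by
    intro x
    obtain ⟨y, hy, -⟩ := hp x
    rw [hy]
    exact Sym2.mem_mk_left _ _
  refine ⟨f, ⟨⟨?_, ?_, .inl r, hfr, ?_⟩, hfr⟩, ?_⟩
  · rintro (x | e)
    · by_cases h : x = r
      · rw [h, hfr, hfr]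
      · rw [hfx x h, hfe, Equiv.symm_apply_apply]
    · rw [hfe, hfx _ (p.symm e).2, Equiv.apply_symm_apply]
  · rintro (x | e)
    · by_cases h : x = r
      · exact Or.inl (h ▸ hfr)
      · right
        rw [hfx x h]
        exact hmem ⟨x, h⟩
    · right
      rw [hfe]
      have := hmem (p.symm e)
      rwa [Equiv.apply_symm_apply] at this
  · rintro (x | e) h
    · by_contra h'
      rw [hfx x (fun h2 => h' (h2 ▸ rfl))] at h
      exact absurd h (by simp)
    · exact absurd h (by simp [f])
  · rintro g ⟨⟨hgg, hgH, hgu⟩, hgr⟩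
    -- by induction on the distance from `r`, `g` matches `x` to its parent edge
    have hgx : ∀ n x (h : x ≠ r), T.dist r x = n → g (.inl x) = .inr (p ⟨x, h⟩) := by
      intro n
      induction n using Nat.strong_induction_on with
      | _ n ih =>
        intro x h hn
        obtain ⟨y, hy, hd⟩ := hp ⟨x, h⟩
        rcases hgH (.inr (p ⟨x, h⟩)) with h1 | h1
        · exact absurd (hgu.unique h1 hgr) (by simp)
        · rcases hz : g (.inr (p ⟨x, h⟩)) with z | z
          · rw [hz] at h1
            have h2 : z ∈ ((p ⟨x, h⟩ : T.edgeSet) : Sym2 V) := h1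
            have h3 : g (.inl z) = .inr (p ⟨x, h⟩) := by rw [← hz, hgg]
            rw [hy, Sym2.mem_iff] at h2
            rcases h2 with rfl | rfl
            · exact h3
            · have hzr : z ≠ r := by
                rintro rfl
                rw [hgr] at h3
                exact absurd h3 (by simp)
              have h4 := ih _ (hn ▸ hd) z hzr rfl
              rw [h3] at h4
              have h5 := congrArg Subtype.val (p.injective (Sum.inr_injective h4))
              dsimp only at h5
              subst h5
              exact absurd hd (lt_irrefl _)
          · rw [hz] at h1
            exact h1.elim
    funext x
    rcases x with x | e
    · by_cases h : x = r
      · rw [h, hgr, hfr]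
      · rw [hgx _ x h rfl, hfx x h]
    · have h : g (.inl (p.symm e).1) = .inr e := by
        rw [hgx _ _ (p.symm e).2 rfl, Subtype.coe_eta, Equiv.apply_symm_apply]
      rw [hfe, ← h, hgg]

/-- The near-perfect matchings of the subdivision of a tree correspond to their unmatched vertex,
and a slide moves that vertex along an edge of the tree. -/
theorem nonempty_slideGraph_subdivision_iso [Finite V] (hT : T.IsTree) :
    Nonempty (slideGraph (subdivision T) ≃g T) := by
  have hcard := (SimpleGraph.isTree_iff_connected_and_card.1 hT).2
  choose F hF using fun r => (existsUnique_nearPerfectMatching_subdivision hT r).exists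
  let Φ : V → NearPerfectMatching (subdivision T) := fun r => ⟨F r, (hF r).1⟩
  have hΦ : ∀ r, (Φ r).1 (.inl r) = .inl r := fun r => (hF r).2
  have huniq : ∀ (f : NearPerfectMatching (subdivision T)) r,
      f.1 (.inl r) = .inl r → f = Φ r := fun f r h => Subtype.ext
    ((existsUnique_nearPerfectMatching_subdivision hT r).unique ⟨f.2, h⟩ ⟨(Φ r).2, hΦ r⟩)
  have hleft : ∀ f : NearPerfectMatching (subdivision T),
      ∃ r, f.1 (.inl r) = .inl r := by
    intro f
    rcases hu : unmatched f with r | e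
    · exact ⟨r, hu ▸ apply_unmatched f⟩
    · exfalso
      have h := card_le_of_fixed f.2 (fun x => x.isLeft = true)
        (by rintro (x | x) (y | y) h <;> simp_all [subdivision]) (apply_unmatched f)
        (by simp [hu])
      have h1 : Nat.card {x : V ⊕ T.edgeSet // x.isLeft = true} = Nat.card V :=
        Nat.card_congr ⟨fun x => x.1.getLeft x.2, fun v => ⟨.inl v, rfl⟩,
          by rintro ⟨_ | _, h⟩ <;> simp_all, fun _ => rfl⟩
      have h2 : Nat.card {x : V ⊕ T.edgeSet // ¬ x.isLeft = true} = Nat.card T.edgeSet :=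
        Nat.card_congr ⟨fun x => x.1.getRight (by simpa using x.2), fun v => ⟨.inr v, by simp⟩,
          by rintro ⟨_ | _, h⟩ <;> simp_all, fun _ => rfl⟩
      omega
  have hbij : Function.Bijective Φ := by
    constructor
    · intro r s h
      have h1 := hΦ s
      rw [← h] at h1
      exact Sum.inl_injective ((Φ r).2.2.2.unique (hΦ r) h1)
    · intro f
      obtain ⟨r, hr⟩ := hleft f
      exact ⟨r, (huniq f r hr).symm⟩
  refine ⟨RelIso.symm ⟨Equiv.ofBijective Φ hbij, ?_⟩⟩
  intro r s
  rw [Equiv.ofBijective_apply, Equiv.ofBijective_apply]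
  constructor
  · rintro ⟨a, b, v, hab, hfa, hfv, hgb, hgv, -⟩
    obtain rfl := (Φ r).2.2.2.unique hfa (hΦ r)
    obtain rfl := (Φ s).2.2.2.unique hgb (hΦ s)
    have h1 : v ≠ .inl s := fun h => hab ((Φ r).2.2.2.unique hfa (h ▸ hfv))
    have h2 : v ≠ .inl r := fun h => hab ((Φ s).2.2.2.unique (h ▸ hgv) hgb)
    have h3 := adj_of_apply_eq _ hfv h1
    have h4 := adj_of_apply_eq _ hgv h2
    rcases v with v | e
    · exact h3.elim
    · have h5 : s ∈ (e : Sym2 V) := h3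
      have h6 : r ∈ (e : Sym2 V) := h4
      have h7 := (Sym2.mem_and_mem_iff (fun h => hab (congrArg Sum.inl h))).1 ⟨h6, h5⟩
      have h8 := e.2
      rwa [h7] at h8
  · intro h
    obtain ⟨g, hg, hg1, -, -⟩ := exists_slide (Φ r) (v := .inr ⟨s(r, s), h⟩) (hΦ r)
      (Sym2.mem_mk_left r s)
    rcases (Φ r).2.2.1 (.inr ⟨s(r, s), h⟩) with h1 | h1
    · exact absurd ((Φ r).2.2.2.unique h1 (hΦ r)) (by simp)
    · rcases hz : (Φ r).1 (.inr ⟨s(r, s), h⟩) with z | z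
      · rw [hz] at h1 hg1
        have h2 : z ∈ s(r, s) := h1
        rw [Sym2.mem_iff] at h2
        rcases h2 with rfl | rfl
        · have h3 := (Φ z).2.1 (.inr ⟨s(z, s), h⟩)
          rw [hz, hΦ] at h3
          exact absurd h3 (by simp)
        · rwa [huniq g z hg1] at hg
      · rw [hz] at h1
        exact h1.elim

theorem nonempty_bellColoringGraph_subdivision_iso [Finite V] (hT : T.IsTree) :
    Nonempty (bellColoringGraph (subdivision T)ᶜ (Nat.card V) ≃g T) := by
  have hcard := (SimpleGraph.isTree_iff_connected_and_card.1 hT).2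
  obtain ⟨e⟩ := nonempty_bellColoringGraph_compl_iso_slideGraph (H := subdivision T)
    (m := Nat.card T.edgeSet) (by rw [Nat.card_sum]; omega) subdivision_triangleFree
  obtain ⟨e'⟩ := nonempty_slideGraph_subdivision_iso hT
  exact hcard ▸ ⟨e.trans e'⟩

end

/-! ### Ear graphs -/

section

/-- The ear graph has two Hamiltonian paths: `v_{2k-1}, …, v₁` flanked by its two further
vertices, in either order. `earRank k b x` is the position of `x` on such a path; `b` tells
whether it starts at `u` or at `w`. -/
def earRank (k : ℕ) (b : Bool) : Fin 2 ⊕ Fin (2 * k - 1) → ℕ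
  | .inl i => if decide (i = 0) = b then 0 else 2 * k
  | .inr i => 2 * k - 1 - i.val

variable {k : ℕ}

theorem earGraph_adj_iff (hk : 2 ≤ k) (b : Bool) (x y : Fin 2 ⊕ Fin (2 * k - 1)) :
    (earGraph (2 * k)).Adj x y ↔
      earRank k b y = earRank k b x + 1 ∨ earRank k b x = earRank k b y + 1 ∨
      (earRank k b x = 0 ∧ earRank k b y + 1 = 2 * k) ∨
      (earRank k b y = 0 ∧ earRank k b x + 1 = 2 * k) ∨
      (earRank k b x = 1 ∧ earRank k b y = 2 * k) ∨
      (earRank k b y = 1 ∧ earRank k b x = 2 * k) := by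
  rcases x with x | x <;> rcases y with y | y <;> simp only [earGraph, earRank]
  · grind
  · have := y.2
    grind
  · have := x.2
    grind
  · have := x.2
    have := y.2
    omega

theorem earRank_le (b : Bool) (x : Fin 2 ⊕ Fin (2 * k - 1)) : earRank k b x ≤ 2 * k := by
  rcases x with x | x <;> simp only [earRank]
  · split_ifs <;> omega
  · omega

theorem earRank_injective (hk : 2 ≤ k) (b : Bool) : Function.Injective (earRank k b) := by
  rintro (x | x) (y | y) h <;> simp only [earRank] at h
  · congr 1
    by_cases hx : decide (x = 0) = b <;> by_cases hy : decide (y = 0) = b <;>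
      simp only [hx, hy, if_true, if_false] at h
    · have := hx.trans hy.symm
      rw [decide_eq_decide] at this
      omega
    · omega
    · omega
    · have : decide (x = 0) = decide (y = 0) := by
        revert hx hy
        cases decide (x = 0) <;> cases decide (y = 0) <;> cases b <;> simp
      rw [decide_eq_decide] at this
      omega
  · have := y.2
    split_ifs at h <;> omega
  · have := x.2
    split_ifs at h <;> omega
  · have := x.2
    have := y.2
    congr 1
    omega

theorem exists_earRank_eq (b : Bool) {j : ℕ} (hj : j ≤ 2 * k) : ∃ x, earRank k b x = j := by
  by_cases h0 : j = 0
  · refine ⟨.inl (if b then 0 else 1), ?_⟩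
    cases b <;> simp [earRank, h0]
  · by_cases h1 : j = 2 * k
    · refine ⟨.inl (if b then 1 else 0), ?_⟩
      cases b <;> simp [earRank, h1]
    · refine ⟨.inr ⟨2 * k - 1 - j, by omega⟩, ?_⟩
      simp only [earRank]
      omega

/-- Reversing the choice of `b` exchanges the two ends of the path and nothing else. -/
theorem earRank_not (b : Bool) (x : Fin 2 ⊕ Fin (2 * k - 1)) :
    earRank k (!b) x = if earRank k b x = 0 then 2 * k else
      if earRank k b x = 2 * k then 0 else earRank k b x := by
  rcases x with x | x
  · simp only [earRank, Bool.eq_not]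
    grind
  · have := x.2
    have h : ∀ c, earRank k c (.inr x) = 2 * k - 1 - x.val := fun _ => rfl
    rw [h, h, if_neg (by omega), if_neg (by omega)]

/-- All matching edges lie on the Hamiltonian path given by `b`. -/
def AlongEarPath (k : ℕ) (b : Bool) (f : Fin 2 ⊕ Fin (2 * k - 1) → Fin 2 ⊕ Fin (2 * k - 1)) :
    Prop :=
  ∀ x, f x = x ∨ earRank k b (f x) = earRank k b x + 1 ∨ earRank k b x = earRank k b (f x) + 1

theorem alongEarPath_or_not (hk : 2 ≤ k) (f : NearPerfectMatching (earGraph (2 * k))) (b : Bool) :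
    AlongEarPath k b f.1 ∨ AlongEarPath k (!b) f.1 := by
  by_contra! h
  obtain ⟨h1, h2⟩ := h
  simp only [AlongEarPath, not_forall, not_or] at h1 h2
  obtain ⟨x, hx, hx1, hx2⟩ := h1
  obtain ⟨y, hy, hy1, hy2⟩ := h2
  have hax := (earGraph_adj_iff hk b _ _).1 ((f.2.2.1 x).resolve_left hx)
  have hay := (earGraph_adj_iff hk b _ _).1 ((f.2.2.1 y).resolve_left hy)
  rw [earRank_not, earRank_not] at hy1 hy2
  have hr : ∀ x y, earRank k b x = earRank k b y → earRank k b (f.1 x) = earRank k b (f.1 y) :=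
    fun x y h => by rw [earRank_injective hk b h]
  have e1 := hr x y
  have e2 := hr x (f.1 y)
  have e3 := hr (f.1 x) y
  have e4 := hr (f.1 x) (f.1 y)
  rw [f.2.1] at e2 e3 e4
  rw [f.2.1] at e4
  have l1 := earRank_le b y
  have l2 := earRank_le b (f.1 y)
  generalize earRank k b x = p at *
  generalize earRank k b (f.1 x) = q at *
  generalize earRank k b y = r at *
  generalize earRank k b (f.1 y) = s at *
  split_ifs at hy1 hy2 <;> omega

theorem not_alongEarPath_and_not (hk : 2 ≤ k) (f : NearPerfectMatching (earGraph (2 * k)))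
    (b : Bool) :
    ¬ (AlongEarPath k b f.1 ∧ AlongEarPath k (!b) f.1) := by
  rintro ⟨h1, h2⟩
  obtain ⟨u, hu⟩ := exists_earRank_eq (k := k) b (Nat.zero_le _)
  obtain ⟨w, hw⟩ := exists_earRank_eq (k := k) b le_rfl
  have key : ∀ x, f.1 x ≠ x → earRank k b x = 0 ∨ earRank k b x = 2 * k → False := by
    intro x hx hr
    have h3 := (h1 x).resolve_left hx
    have h4 := (h2 x).resolve_left hx
    have := earRank_le b (f.1 x)
    rw [earRank_not, earRank_not] at h4
    grind
  have hfu : f.1 u = u := by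
    by_contra h
    exact key u h (Or.inl hu)
  have hfw : f.1 w = w := by
    by_contra h
    exact key w h (Or.inr hw)
  have := f.2.2.2.unique hfu hfw
  rw [this, hw] at hu
  omega

/-- From the start of the path up to the unmatched vertex, the matching consists of every other
edge. -/
theorem AlongEarPath.pairs_below (hk : 2 ≤ k) {f : NearPerfectMatching (earGraph (2 * k))}
    {b : Bool} (h : AlongEarPath k b f.1)
    {a : Fin 2 ⊕ Fin (2 * k - 1)} (ha : f.1 a = a) (j : ℕ) :
    ∀ x, earRank k b x = 2 * j → earRank k b x < earRank k b a →
      earRank k b (f.1 x) = earRank k b x + 1 := by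
  induction j with
  | zero =>
    intro x hx hxa
    rcases h x with h1 | h1 | h1
    · rw [f.2.2.2.unique h1 ha] at hxa
      exact absurd hxa (lt_irrefl _)
    · exact h1
    · omega
  | succ j ih =>
    intro x hx hxa
    rcases h x with h1 | h1 | h1
    · rw [f.2.2.2.unique h1 ha] at hxa
      exact absurd hxa (lt_irrefl _)
    · exact h1
    · exfalso
      have := earRank_le b a
      obtain ⟨y, hy⟩ := exists_earRank_eq (k := k) b (j := 2 * j) (by omega)
      have h2 := ih y hy (by omega)
      have h3 : f.1 y = f.1 x := earRank_injective hk b (by omega)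
      have h4 := congrArg f.1 h3
      rw [f.2.1, f.2.1] at h4
      rw [h4] at hy
      omega

theorem AlongEarPath.even_unmatched (hk : 2 ≤ k) {f : NearPerfectMatching (earGraph (2 * k))}
    {b : Bool} (h : AlongEarPath k b f.1)
    {a : Fin 2 ⊕ Fin (2 * k - 1)} (ha : f.1 a = a) : ∃ j, earRank k b a = 2 * j := by
  by_contra! hodd
  have := hodd (earRank k b a / 2)
  have hle := earRank_le b a
  obtain ⟨x, hx⟩ := exists_earRank_eq (k := k) b (j := 2 * (earRank k b a / 2)) (by omega)
  have h1 := h.pairs_below hk ha _ x hx (by omega)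
  have h2 : f.1 x = a := earRank_injective hk b (by omega)
  have h3 : x = a := by rw [← f.2.1 x, h2, ha]
  rw [h3] at hx
  exact this hx

theorem AlongEarPath.eq (hk : 2 ≤ k) {f g : NearPerfectMatching (earGraph (2 * k))}
    {b : Bool} (hf : AlongEarPath k b f.1)
    (hg : AlongEarPath k b g.1) {a : Fin 2 ⊕ Fin (2 * k - 1)} (hfa : f.1 a = a)
    (hga : g.1 a = a) : f = g := by
  refine Subtype.ext (eq_of_rank f.2.1 g.2.1 (earRank k b) fun x => ?_)
  rcases hf x with h1 | h1 | h1
  · have := f.2.2.2.unique h1 hfa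
    subst this
    exact Or.inr (Or.inr (hfa.trans hga.symm))
  · rcases hg x with h2 | h2 | h2
    · have := g.2.2.2.unique h2 hga
      subst this
      exact Or.inr (Or.inr (hfa.trans hga.symm))
    · exact Or.inr (Or.inr (earRank_injective hk b (h1.trans h2.symm)))
    · exact Or.inr (Or.inl (by omega))
  · exact Or.inl (by omega)

/-- A slide along an edge of the path moves the unmatched vertex by two positions; a slide along an
edge off the path takes the unmatched vertex from one end of the path to the other, and the
matching to the other Hamiltonian path. -/
theorem AlongEarPath.slide (hk : 2 ≤ k) {f g : NearPerfectMatching (earGraph (2 * k))}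
    {b : Bool} (hf : AlongEarPath k b f.1)
    {a v : Fin 2 ⊕ Fin (2 * k - 1)} (hfa : f.1 a = a) (hav : (earGraph (2 * k)).Adj a v)
    (hgb : g.1 (f.1 v) = f.1 v) (hga : g.1 a = v)
    (hoff : ∀ x, x ≠ a → x ≠ v → x ≠ f.1 v → g.1 x = f.1 x) :
    (AlongEarPath k b g.1 ∧
      (earRank k b v = earRank k b a + 1 ∧ earRank k b (f.1 v) = earRank k b a + 2 ∨
        earRank k b a = earRank k b v + 1 ∧ earRank k b a = earRank k b (f.1 v) + 2)) ∨
    (AlongEarPath k (!b) g.1 ∧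
      (earRank k b a = 0 ∧ earRank k b v + 1 = 2 * k ∧ earRank k b (f.1 v) = 2 * k ∨
        earRank k b a = 2 * k ∧ earRank k b v = 1 ∧ earRank k b (f.1 v) = 0)) := by
  obtain ⟨j, hj⟩ := hf.even_unmatched hk hfa
  have hinj := earRank_injective hk b
  have hne : a ≠ v := hav.ne
  have hfv : f.1 v ≠ v := fun h => hne (f.2.2.2.unique hfa h)
  have hfva : f.1 v ≠ a := fun h => hne (by rw [← hfa, ← h, f.2.1])
  have hra : earRank k b (f.1 v) ≠ earRank k b a := hinj.ne hfva
  have hle := earRank_le b (f.1 v)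
  have hv := (hf v).resolve_left hfv
  have hgv : g.1 v = a := by rw [← hga, g.2.1]
  have hstay : earRank k b v = earRank k b a + 1 ∨ earRank k b a = earRank k b v + 1 →
      AlongEarPath k b g.1 := by
    intro h x
    by_cases h1 : x = a
    · rw [h1, hga]
      exact Or.inr h
    by_cases h2 : x = v
    · rw [h2, hgv]
      exact Or.inr h.symm
    by_cases h3 : x = f.1 v
    · rw [h3, hgb]
      exact Or.inl rfl
    rw [hoff x h1 h2 h3]
    exact hf x
  have hcross : (earRank k b a = 0 ∧ earRank k b v + 1 = 2 * k ∧ earRank k b (f.1 v) = 2 * k ∨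
        earRank k b a = 2 * k ∧ earRank k b v = 1 ∧ earRank k b (f.1 v) = 0) →
      AlongEarPath k (!b) g.1 := by
    intro h x
    by_cases h1 : x = a
    · rw [h1, hga, earRank_not, earRank_not]
      right
      split_ifs <;> omega
    by_cases h2 : x = v
    · rw [h2, hgv, earRank_not, earRank_not]
      right
      split_ifs <;> omega
    by_cases h3 : x = f.1 v
    · rw [h3, hgb]
      exact Or.inl rfl
    rw [hoff x h1 h2 h3]
    have h4 : f.1 x ≠ a := fun h => h1 (by rw [← f.2.1 x, h, hfa])
    have h5 : f.1 x ≠ f.1 v := fun h => h2 (by rw [← f.2.1 x, h, f.2.1])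
    have r1 := hinj.ne h1
    have r3 := hinj.ne h3
    have r4 := hinj.ne h4
    have r5 := hinj.ne h5
    rcases hf x with h6 | h6
    · exact Or.inl h6
    · right
      rw [earRank_not, earRank_not]
      split_ifs <;> omega
  rcases (earGraph_adj_iff hk b _ _).1 hav with h | h | h | h | h | h
  · exact Or.inl ⟨hstay (Or.inl h), by omega⟩
  · exact Or.inl ⟨hstay (Or.inr h), by omega⟩
  · have hw : earRank k b (f.1 v) = 2 * k := by
      obtain ⟨w, hw⟩ := exists_earRank_eq (k := k) b le_rfl
      rcases hf w with h1 | h1 | h1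
      · have := f.2.2.2.unique h1 hfa
        rw [this] at hw
        omega
      · have := earRank_le b (f.1 w)
        omega
      · have h2 : f.1 w = v := hinj (by omega)
        rw [← h2, f.2.1, hw]
    have h' := Or.inl (b := earRank k b a = 2 * k ∧ earRank k b v = 1 ∧
      earRank k b (f.1 v) = 0) (And.intro h.1 (And.intro h.2 hw))
    exact Or.inr ⟨hcross h', h'⟩
  · omega
  · omega
  · have hu : earRank k b (f.1 v) = 0 := by
      obtain ⟨u, hu⟩ := exists_earRank_eq (k := k) b (Nat.zero_le _)
      have h1 := hf.pairs_below hk hfa 0 u hu (by omega)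
      have h2 : f.1 u = v := hinj (by omega)
      rw [← h2, f.2.1, hu]
    have h' := Or.inr (a := earRank k b a = 0 ∧ earRank k b v + 1 = 2 * k ∧
      earRank k b (f.1 v) = 2 * k) (And.intro h.2 (And.intro h.1 hu))
    exact Or.inr ⟨hcross h', h'⟩

open Fin.CommRing

/-- The position on the cycle `C_{2k+2}` of the near-perfect matching that lies on the path given
by `b` and leaves the vertex of rank `2j` unmatched: positions `0, …, k` for one path, and
`-1, …, -1 - k` for the other. -/
def earLabel (k : ℕ) (b : Bool) (j : ℕ) : Fin (2 * k + 2) :=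
  if b then (j : Fin (2 * k + 2)) else -1 - (j : Fin (2 * k + 2))

theorem earLabel_injective {b b' : Bool} {i j : ℕ} (hi : i ≤ k) (hj : j ≤ k)
    (h : earLabel k b i = earLabel k b' j) : b = b' ∧ i = j := by
  have h1 : ∀ {i j : ℕ}, i ≤ k → j ≤ k → ((i : ℕ) : Fin (2 * k + 2)) = (j : ℕ) → i = j := by
    intro i j hi hj h
    have := congrArg Fin.val h
    rwa [Fin.val_natCast, Fin.val_natCast, Nat.mod_eq_of_lt (by omega),
      Nat.mod_eq_of_lt (by omega)] at this
  have h2 : ∀ {i j : ℕ}, i ≤ k → j ≤ k →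
      ((i : ℕ) : Fin (2 * k + 2)) ≠ -1 - ((j : ℕ) : Fin (2 * k + 2)) := by
    intro i j hi hj h
    have h3 : ((i + j + 1 : ℕ) : Fin (2 * k + 2)) = ((0 : ℕ) : Fin (2 * k + 2)) := by
      push_cast
      linear_combination h
    have := congrArg Fin.val h3
    rw [Fin.val_natCast, Fin.val_natCast, Nat.mod_eq_of_lt (by omega),
      Nat.mod_eq_of_lt (by omega)] at this
    omega
  cases b <;> cases b' <;> simp only [earLabel, if_true, if_false, Bool.false_eq_true] at h
  · exact ⟨rfl, h1 hi hj (by linear_combination - h)⟩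
  · exact absurd h.symm (h2 hj hi)
  · exact absurd h (h2 hi hj)
  · exact ⟨rfl, h1 hi hj h⟩

theorem nonempty_slideGraph_earGraph_iso (hk : 2 ≤ k) :
    Nonempty (slideGraph (earGraph (2 * k)) ≃g SimpleGraph.cycleGraph (2 * k + 2)) := by
  have : Nonempty (NearPerfectMatching (earGraph (2 * k))) := by
    let r : Fin 2 ⊕ Fin (2 * k - 1) → Fin (2 * k + 1) := fun x =>
      ⟨earRank k true x, Nat.lt_succ_of_le (earRank_le true x)⟩
    have hr : Function.Bijective r := by
      constructor
      · intro x y h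
        exact earRank_injective hk true (congrArg Fin.val h)
      · intro i
        obtain ⟨x, hx⟩ := exists_earRank_eq (k := k) true (Nat.le_of_lt_succ i.2)
        exact ⟨x, Fin.ext hx⟩
    obtain ⟨f, hf⟩ := exists_nearPerfectMatching_of_path (H := earGraph (2 * k))
      (Equiv.ofBijective r hr) fun x y h => (earGraph_adj_iff hk true x y).2 (Or.inl h.symm)
    exact ⟨⟨f, hf⟩⟩
  have hb : ∀ f : NearPerfectMatching (earGraph (2 * k)), ∃ b, AlongEarPath k b f.1 := fun f =>
    (alongEarPath_or_not hk f true).elim (fun h => ⟨_, h⟩) fun h => ⟨_, h⟩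
  choose b hb using hb
  have hbu : ∀ (f : NearPerfectMatching (earGraph (2 * k))) c, AlongEarPath k c f.1 → b f = c := by
    intro f c hc
    by_contra hne
    have h1 : (!c) = b f := by
      revert hne
      cases b f <;> cases c <;> simp
    exact not_alongEarPath_and_not hk f c ⟨hc, h1 ▸ hb f⟩
  have hj : ∀ f : NearPerfectMatching (earGraph (2 * k)),
      ∃ j, earRank k (b f) (unmatched f) = 2 * j := fun f =>
    (hb f).even_unmatched hk (apply_unmatched f)
  choose j hj using hj
  have hjk : ∀ f, j f ≤ k := fun f => by
    have := earRank_le (b f) (unmatched f)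
    have := hj f
    omega
  have hlab : ∀ (f : NearPerfectMatching (earGraph (2 * k))) c a i, AlongEarPath k c f.1 →
      f.1 a = a → earRank k c a = 2 * i →
      earLabel k (b f) (j f) = earLabel k c i := by
    intro f c a i hc ha hi
    have h1 := hj f
    rw [hbu f c hc, ← eq_unmatched ha] at h1
    rw [hbu f c hc, show j f = i by omega]
  have hwrap : ((2 * k + 2 : ℕ) : Fin (2 * k + 2)) = 0 := Fin.natCast_self _
  push_cast at hwrap
  have hup : ∀ i, i < k → (earLabel k true (i + 1) = earLabel k true i + 1 ∧
      earLabel k false i = earLabel k false (i + 1) + 1) := by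
    intro i _
    refine ⟨by simp [earLabel], ?_⟩
    simp only [earLabel, Bool.false_eq_true, if_false, Nat.cast_add, Nat.cast_one]
    ring
  have hzero : earLabel k true 0 = earLabel k false 0 + 1 := by
    simp [earLabel]
  have hk' : earLabel k false k = earLabel k true k + 1 := by
    simp only [earLabel, if_true, Bool.false_eq_true, if_false]
    linear_combination - hwrap
  refine nonempty_iso_cycleGraph (fun f => earLabel k (b f) (j f)) ?_ ?_ ?_
  · intro f g h
    obtain ⟨h1, h2⟩ := earLabel_injective (hjk f) (hjk g) h
    have h3 : unmatched f = unmatched g := by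
      apply earRank_injective hk (b f)
      rw [hj f, h1, hj g, h2]
    exact (hb f).eq hk (h1 ▸ hb g) (apply_unmatched f) (h3 ▸ apply_unmatched g)
  · rintro f g ⟨a, c, v, hac, hfa, rfl, hgc, hgv, hoff⟩
    have hga : g.1 a = v := by rw [← hgv, g.2.1]
    have hva : a ≠ v := by
      rintro rfl
      exact hac (g.2.2.2.unique hga hgc)
    have hav := (adj_of_apply_eq g hgv hva.symm).symm
    have hra := hj f
    rw [← eq_unmatched hfa] at hra
    have hle := hjk f
    have hle' := earRank_le (b f) (f.1 v)
    rcases (hb f).slide hk hfa hav hgc hga (fun x h1 h2 h3 => (hoff x h1 h3 h2).symm) with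
      ⟨hg, ⟨-, h⟩ | ⟨-, h⟩⟩ | ⟨hg, ⟨h1, -, h2⟩ | ⟨h1, -, h2⟩⟩
    · rw [hlab g _ _ (j f + 1) hg hgc (by omega)]
      have := hup (j f) (by omega)
      cases b f
      · exact Or.inr this.2
      · exact Or.inl this.1
    · obtain ⟨i, hi⟩ : ∃ i, j f = i + 1 := ⟨j f - 1, by omega⟩
      rw [hlab g _ _ i hg hgc (by omega), hi]
      have := hup i (by omega)
      cases b f
      · exact Or.inl this.2
      · exact Or.inr this.1
    · have hn : earRank k (!(b f)) (f.1 v) = 2 * 0 := by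
        rw [earRank_not]
        grind
      rw [hlab g _ _ 0 hg hgc hn, show j f = 0 by omega]
      cases b f
      · exact Or.inl hzero
      · exact Or.inr hzero
    · have hn : earRank k (!(b f)) (f.1 v) = 2 * k := by
        rw [earRank_not, if_pos h2]
      rw [hlab g _ _ k hg hgc hn, show j f = k by omega]
      cases b f
      · exact Or.inr hk'
      · exact Or.inl hk'
  · intro f
    have hra := hj f
    have hle := hjk f
    -- the label increases upwards along one path and downwards along the other
    have hbf := hb f
    cases hc : b f
    · rw [hc] at hra hbf
      by_cases h0 : j f = 0
      · obtain ⟨v, hv⟩ := exists_earRank_eq (k := k) false (j := 2 * k - 1) (by omega)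
        have hv' := (earGraph_adj_iff hk false (unmatched f) v).2 (by omega)
        obtain ⟨g, h1, h2, hg1, hg2⟩ := exists_slide f (apply_unmatched f) hv'
        rcases hbf.slide hk (apply_unmatched f) hv' h2 hg1 hg2 with ⟨-, h3⟩ | ⟨hg, h3⟩
        · omega
        · refine ⟨g, h1, ?_⟩
          have hn : earRank k (!false) (f.1 v) = 2 * 0 := by
            rw [earRank_not]
            grind
          rw [hlab g _ _ 0 hg h2 hn, h0]
          exact hzero
      · obtain ⟨i, hi⟩ : ∃ i, j f = i + 1 := ⟨j f - 1, by omega⟩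
        obtain ⟨v, hv⟩ := exists_earRank_eq (k := k) false (j := 2 * i + 1) (by omega)
        have hv' := (earGraph_adj_iff hk false (unmatched f) v).2 (by omega)
        obtain ⟨g, h1, h2, hg1, hg2⟩ := exists_slide f (apply_unmatched f) hv'
        rcases hbf.slide hk (apply_unmatched f) hv' h2 hg1 hg2 with ⟨hg, h3⟩ | ⟨hg, h3⟩
        · refine ⟨g, h1, ?_⟩
          rw [hlab g _ _ i hg h2 (by omega), hi]
          exact (hup i (by omega)).2
        · omega
    · rw [hc] at hra hbf
      by_cases h0 : j f = k
      · obtain ⟨v, hv⟩ := exists_earRank_eq (k := k) true (j := 1) (by omega)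
        have hv' := (earGraph_adj_iff hk true (unmatched f) v).2 (by omega)
        obtain ⟨g, h1, h2, hg1, hg2⟩ := exists_slide f (apply_unmatched f) hv'
        rcases hbf.slide hk (apply_unmatched f) hv' h2 hg1 hg2 with ⟨-, h3⟩ | ⟨hg, h3⟩
        · have := earRank_le true (f.1 v)
          omega
        · refine ⟨g, h1, ?_⟩
          have hn : earRank k (!true) (f.1 v) = 2 * k := by
            rw [earRank_not, if_pos (by omega)]
          rw [hlab g _ _ k hg h2 hn, h0]
          exact hk'
      · obtain ⟨v, hv⟩ := exists_earRank_eq (k := k) true (j := 2 * j f + 1) (by omega)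
        have hv' := (earGraph_adj_iff hk true (unmatched f) v).2 (by omega)
        obtain ⟨g, h1, h2, hg1, hg2⟩ := exists_slide f (apply_unmatched f) hv'
        rcases hbf.slide hk (apply_unmatched f) hv' h2 hg1 hg2 with ⟨hg, h3⟩ | ⟨hg, h3⟩
        · refine ⟨g, h1, ?_⟩
          rw [hlab g _ _ (j f + 1) hg h2 (by omega)]
          exact (hup (j f) (by omega)).1
        · omega

theorem nonempty_bellColoringGraph_earGraph_iso (hk : 2 ≤ k) :
    Nonempty (bellColoringGraph (earGraph (2 * k))ᶜ (k + 1) ≃g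
      SimpleGraph.cycleGraph (2 * k + 2)) := by
  obtain ⟨e⟩ := nonempty_bellColoringGraph_compl_iso_slideGraph (m := k)
    (H := earGraph (2 * k)) (by simp; omega) (by
      intro x y z
      rw [earGraph_adj_iff hk true, earGraph_adj_iff hk true, earGraph_adj_iff hk true]
      omega)
  obtain ⟨e'⟩ := nonempty_slideGraph_earGraph_iso hk
  exact ⟨e.trans e'⟩

end

end BellColoring

theorem mainTheorem2 :
    (∀ (V : Type u) [Finite V] (T : SimpleGraph V), T.IsTree →
      BellColoring.IsBellColoringGraph T) ∧
    (∀ n : ℕ, 3 ≤ n → BellColoring.IsBellColoringGraph (SimpleGraph.cycleGraph n)) ∧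
    (∀ k : ℕ, 2 ≤ k →
      Nonempty (BellColoring.bellColoringGraph (SimpleGraph.cycleGraph (2 * k + 1))ᶜ (k + 1) ≃g
        SimpleGraph.cycleGraph (2 * k + 1))) ∧
    (∀ k : ℕ, 2 ≤ k →
      Nonempty (BellColoring.bellColoringGraph (BellColoring.earGraph (2 * k))ᶜ (k + 1) ≃g
        SimpleGraph.cycleGraph (2 * k + 2))) ∧
    (∀ (V : Type u) [Finite V] (T : SimpleGraph V), T.IsTree →
      Nonempty (BellColoring.bellColoringGraph (BellColoring.subdivision T)ᶜ (Nat.card V) ≃g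
        T)) := by
  refine ⟨fun V _ T hT => ?_, fun n hn => ?_,
    fun k hk => BellColoring.nonempty_bellColoringGraph_oddCycle_iso hk,
    fun k hk => BellColoring.nonempty_bellColoringGraph_earGraph_iso hk,
    fun V _ T hT => BellColoring.nonempty_bellColoringGraph_subdivision_iso hT⟩
  · have := hT.connected.nonempty
    exact ⟨V ⊕ T.edgeSet, inferInstance, (BellColoring.subdivision T)ᶜ, Nat.card V,
      Nat.card_pos, BellColoring.nonempty_bellColoringGraph_subdivision_iso hT⟩
  · by_cases h3 : n = 3
    · exact h3 ▸ BellColoring.isBellColoringGraph_cycleGraph_three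
    by_cases h4 : n = 4
    · exact h4 ▸ BellColoring.isBellColoringGraph_cycleGraph_four
    rcases Nat.even_or_odd' n with ⟨m, rfl | rfl⟩
    · obtain ⟨k, rfl⟩ : ∃ k, m = k + 1 := ⟨m - 1, by omega⟩
      exact ⟨_, inferInstance, _, k + 1, by omega,
        BellColoring.nonempty_bellColoringGraph_earGraph_iso (by omega)⟩
    · exact ⟨_, inferInstance, _, m + 1, by omega,
        BellColoring.nonempty_bellColoringGraph_oddCycle_iso (by omega)⟩
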